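/- Let $G$ be a finite group that is $\mathcal N$-constrained, i.e. $C_G(F(G))\le F(G)$, where $F(G)$ is the Fitting subgroup of $G$ (the subgroup generated by all nilpotent normal subgroups of $G$). A subgroup $I\le G$ is called a nilpotent injector of $G$ if, for every subnormal subgroup $S$ of $G$, the intersection $S\cap I$ is a maximal nilpotent subgroup of $S$ (that is, maximal with respect to inclusion among the nilpotent subgroups of $S$). If $G$ is nilpotent, set $m_G=1$. Otherwise set \[ m_G=\gcd\{\,p-1 : p \text{ prime},\ p \mid (G:I) \text{ for some nilpotent injector } I \text{ of } G\,\}. \] For $H\le G$, let $n_{\mathfrak I}(G,H)$ be the number of nilpotent injectors of $G$ that contain $H$. Then for every subgroup $H\le G$, either $n_{\mathfrak I}(G,H)=0$ or $n_{\mathfrak I}(G,H)\equiv 1 \pmod{m_G}$. -/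

import Mathlib

/-- The Fitting subgroup of `G`: the subgroup generated by all nilpotent normal subgroups. -/
def fittingSubgroup (G : Type*) [Group G] : Subgroup G :=
  sSup {N : Subgroup G | N.Normal ∧ Group.IsNilpotent N}

/-- `G` is `𝒩`-constrained: the Fitting subgroup of `G` contains its own centralizer in `G`. -/
def IsNConstrained (G : Type*) [Group G] : Prop :=
  Subgroup.centralizer (fittingSubgroup G : Set G) ≤ fittingSubgroup G

/-- `M` is a maximal nilpotent subgroup of `S`: it is maximal with respect to inclusion
among the nilpotent subgroups of `G` that are contained in `S`. -/
def IsMaximalNilpotentIn {G : Type*} [Group G] (S M : Subgroup G) : Prop :=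
  Maximal (fun K : Subgroup G => K ≤ S ∧ Group.IsNilpotent K) M

/-- `I` is a nilpotent injector of `G`: for every subnormal subgroup `S` of `G`, the intersection
`S ⊓ I` is a maximal nilpotent subgroup of `S`. -/
def IsNilpotentInjector {G : Type*} [Group G] (I : Subgroup G) : Prop :=
  ∀ S : Subgroup G, S.IsSubnormal → IsMaximalNilpotentIn S (S ⊓ I)

/-- The set of nilpotent injectors of `G` that contain `H`. -/
def nilpotentInjectorsContaining {G : Type*} [Group G] (H : Subgroup G) : Set (Subgroup G) :=
  {I | IsNilpotentInjector I ∧ H ≤ I}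

/-- The number of nilpotent injectors of `G` that contain `H` (for finite `G`). -/
noncomputable def numNilpotentInjectors {G : Type*} [Group G] (H : Subgroup G) : ℕ :=
  (nilpotentInjectorsContaining H).ncard

open Classical in
/-- For finite `G`: `1` if `G` is nilpotent, and otherwise the greatest common divisor of the
numbers `p - 1`, where `p` runs over the primes dividing the index `(G : I)` of a nilpotent
injector `I` of `G`. Such a prime divides `|G|`, so it suffices to run over the prime factors
of `|G|`. -/
noncomputable def injectorModulus (G : Type*) [Group G] : ℕ :=
  if Group.IsNilpotent G then 1
  else ((Nat.card G).primeFactors.filter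
    (fun p => ∃ I : Subgroup G, IsNilpotentInjector I ∧ p ∣ I.index)).gcd (fun p => p - 1)

open scoped Pointwise

/-! Let F be the Fitting subgroup and D_p the centralizer of the elements of F of order prime to p.
The p-elements of a nilpotent subgroup above F lie in D_p. Since D_p ∩ D_q centralizes F and C(F) ≤
F, p-elements of D_p commute with q-elements of D_q for p ≠ q (`commute_of_mem_coprimeCentralizer`).
Hence the p-elements of a maximal nilpotent subgroup above F form a full Sylow p-subgroup of D_p,
and applying Sylow's theorem one prime at a time makes all these subgroups conjugate
(`IsMaximalNilpotentIn.exists_conj`). So if an injector I exists, the injectors are exactly the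
maximal nilpotent subgroups above F.

Their number is the index of a stabilizer containing I. It divides |G : I|, so it is a product of
primes congruent to 1. For those above a larger H, induct downwards on H: with N the normalizer of
H, compare the intersections I ∩ N with the maximal nilpotent subgroups of N above H. For each T > H
the two counts above T agree, by induction or because both vanish, so the totals agree
(`card_filter_mem_modEq_of_forall_le`). The second total is again an orbit length, with H in the
role of F (`ncard_maximalNilpotent_modEq_one_of_le_normalizer`). -/

/-! ### Elements of prime power order in nilpotent subgroups. -/

/-- A prime dividing the index of S ∩ I in I would divide the index of a Sylow subgroup that S ∩ I
contains. -/
theorem le_of_prime_power_mem {G : Type*} [Group G] [Finite G] {I S : Subgroup G}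
    (h : ∀ p : ℕ, p.Prime → ∀ x ∈ I, (∃ k, x ^ p ^ k = 1) → x ∈ S) : I ≤ S := by
  rw [← Subgroup.relIndex_eq_one, Subgroup.relIndex, Nat.eq_one_iff_not_exists_prime_dvd]
  intro p hp hdvd
  have := Fact.mk hp
  obtain ⟨P⟩ : Nonempty (Sylow p I) := inferInstance
  refine P.not_dvd_index (hdvd.trans (Subgroup.index_dvd_of_le fun x hx => ?_))
  obtain ⟨k, hk⟩ := P.isPGroup' ⟨x, hx⟩
  exact h p hp x x.2 ⟨k, by simpa [Subtype.ext_iff] using hk⟩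

theorem coprime_orderOf_of_prime_power {G : Type*} [Group G] {p q : ℕ} (hp : p.Prime)
    (hq : q.Prime) (hpq : p ≠ q) {x : G} (hx : ∃ k, x ^ q ^ k = 1) : p.Coprime (orderOf x) := by
  obtain ⟨k, hk⟩ := hx
  exact (((Nat.coprime_primes hp hq).2 hpq).pow_right k).coprime_dvd_right
    (orderOf_dvd_of_pow_eq_one hk)

theorem eq_one_of_prime_power_of_coprime {G : Type*} [Group G] {p : ℕ} {x : G}
    (hx : ∃ k, x ^ p ^ k = 1) (h : p.Coprime (orderOf x)) : x = 1 := by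
  obtain ⟨k, hk⟩ := hx
  exact orderOf_eq_one_iff.1
    (Nat.Coprime.eq_one_of_dvd (h.pow_left k).symm (orderOf_dvd_of_pow_eq_one hk))

theorem isPGroup_of_forall_pow {G : Type*} [Group G] {p : ℕ} {Q : Subgroup G}
    (h : ∀ x ∈ Q, ∃ k, x ^ p ^ k = 1) : IsPGroup p Q := by
  rintro ⟨x, hx⟩
  obtain ⟨k, hk⟩ := h x hx
  exact ⟨k, by ext; simpa using hk⟩

theorem isPGroup_zpowers {G : Type*} [Group G] {p : ℕ} {x : G} (hx : ∃ k, x ^ p ^ k = 1) :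
    IsPGroup p (Subgroup.zpowers x) := by
  refine isPGroup_of_forall_pow fun y hy => ?_
  obtain ⟨n, rfl⟩ := Subgroup.mem_zpowers_iff.1 hy
  obtain ⟨k, hk⟩ := hx
  exact ⟨k, by rw [← zpow_natCast, ← zpow_mul, mul_comm, zpow_mul, zpow_natCast, hk, one_zpow]⟩

theorem mem_sylow_of_prime_power {G : Type*} [Group G] [Finite G] {K : Subgroup G}
    [Group.IsNilpotent K] {p : ℕ} [Fact p.Prime] (P : Sylow p K) {x : G} (hx : x ∈ K)
    (h : ∃ k, x ^ p ^ k = 1) : (⟨x, hx⟩ : K) ∈ P := by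
  have h1 : IsPGroup p (Subgroup.zpowers (⟨x, hx⟩ : K)) := by
    obtain ⟨k, hk⟩ := h
    exact isPGroup_zpowers ⟨k, by ext; simpa using hk⟩
  obtain ⟨Q, hQ⟩ := h1.exists_le_sylow
  obtain ⟨g, rfl⟩ := MulAction.exists_smul_eq K P Q
  rw [Sylow.smul_eq_of_normal] at hQ
  exact hQ (Subgroup.mem_zpowers _)

theorem commute_of_coprime_of_isNilpotent {G : Type*} [Group G] [Finite G] {K : Subgroup G}
    (hK : Group.IsNilpotent K) {x y : G} (hx : x ∈ K) (hy : y ∈ K)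
    (h : (orderOf x).Coprime (orderOf y)) : Commute x y := by
  have key : ∀ p q : ℕ, p.Prime → q.Prime → p ≠ q → ∀ a ∈ K, ∀ b ∈ K, (∃ k, a ^ p ^ k = 1) →
      (∃ k, b ^ q ^ k = 1) → Commute a b := by
    intro p q hp hq hpq a ha b hb hap hbq
    have := Fact.mk hp
    have := Fact.mk hq
    obtain ⟨P⟩ : Nonempty (Sylow p K) := inferInstance
    obtain ⟨Q⟩ : Nonempty (Sylow q K) := inferInstance
    have hc := Subgroup.commute_of_normal_of_disjoint (P : Subgroup K) (Q : Subgroup K)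
      inferInstance inferInstance (IsPGroup.disjoint_of_ne p q hpq _ _ P.isPGroup' Q.isPGroup')
      _ _ (mem_sylow_of_prime_power P ha hap) (mem_sylow_of_prime_power Q hb hbq)
    simpa [Commute, SemiconjBy, Subtype.ext_iff] using hc
  have hle : Subgroup.zpowers x ≤ Subgroup.centralizer (Subgroup.zpowers y : Set G) := by
    refine le_of_prime_power_mem fun p hp a ha hap => ?_
    rw [← Subgroup.zpowers_le, Subgroup.le_centralizer_iff]
    refine le_of_prime_power_mem fun q hq b hb hbq => ?_
    rw [Subgroup.mem_centralizer_iff]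
    suffices Commute a b by
      rintro c hc
      obtain ⟨n, rfl⟩ := Subgroup.mem_zpowers_iff.1 hc
      exact (this.zpow_left n)
    have hab : (orderOf a).Coprime (orderOf b) :=
      (h.coprime_dvd_left (orderOf_dvd_of_mem_zpowers ha)).coprime_dvd_right
        (orderOf_dvd_of_mem_zpowers hb)
    by_cases hpq : p = q
    · subst hpq
      by_cases hpb : p ∣ orderOf b
      · rw [eq_one_of_prime_power_of_coprime hap ((hab.coprime_dvd_right hpb).symm)]
        exact Commute.one_left b
      · rw [eq_one_of_prime_power_of_coprime hbq ((Nat.Prime.coprime_iff_not_dvd hp).2 hpb)]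
        exact Commute.one_right a
    · exact key p q hp hq hpq a ((Subgroup.zpowers_le.2 hx) ha) b ((Subgroup.zpowers_le.2 hy) hb)
        hap hbq
  exact ((Subgroup.mem_centralizer_iff.1 (hle (Subgroup.mem_zpowers x))) y
    (Subgroup.mem_zpowers y)).symm

/-! ### Centralizers of the p'-elements of F. -/

/-- The centralizer of the set of elements of `F` whose order is prime to `p`. -/
def coprimeCentralizer {G : Type*} [Group G] (p : ℕ) (F : Subgroup G) : Subgroup G :=
  Subgroup.centralizer {f | f ∈ F ∧ p.Coprime (orderOf f)}

theorem mem_coprimeCentralizer {G : Type*} [Group G] {p : ℕ} {F : Subgroup G} {x : G} :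
    x ∈ coprimeCentralizer p F ↔ ∀ f ∈ F, p.Coprime (orderOf f) → Commute f x := by
  simp only [coprimeCentralizer, Subgroup.mem_centralizer_iff, Set.mem_ofPred_eq, and_imp]
  rfl

theorem mem_coprimeCentralizer_of_isNilpotent {G : Type*} [Group G] [Finite G] {p : ℕ}
    {F K : Subgroup G} (hFK : F ≤ K) (hK : Group.IsNilpotent K) {x : G} (hx : x ∈ K)
    (hxp : ∃ k, x ^ p ^ k = 1) : x ∈ coprimeCentralizer p F := by
  refine mem_coprimeCentralizer.2 fun f hf hpf =>
    commute_of_coprime_of_isNilpotent hK (hFK hf) hx ?_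
  obtain ⟨k, hk⟩ := hxp
  exact ((hpf.pow_left k).coprime_dvd_left (orderOf_dvd_of_pow_eq_one hk)).symm

theorem conj_mem_coprimeCentralizer {G : Type*} [Group G] {p : ℕ} {F : Subgroup G} {x g : G}
    (hg : g ∈ Subgroup.normalizer (F : Set G)) (hx : x ∈ coprimeCentralizer p F) :
    g * x * g⁻¹ ∈ coprimeCentralizer p F := by
  refine mem_coprimeCentralizer.2 fun f hf hpf => ?_
  have h1 : g⁻¹ * f * g ∈ F := by
    simpa using (Subgroup.mem_normalizer_iff.1 (inv_mem hg) f).1 hf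
  have h2 : orderOf (g⁻¹ * f * g) = orderOf f := by
    have := (MulAut.conj g⁻¹).orderOf_eq f
    simpa using this
  have h3 := mem_coprimeCentralizer.1 hx _ h1 (h2 ▸ hpf)
  have := h3.map (MulAut.conj g).toMonoidHom
  simpa [mul_assoc] using this

/-- F is generated by elements of prime power order, and the order of each is prime to p or to q. -/
theorem inf_coprimeCentralizer_le {G : Type*} [Group G] [Finite G] {p q : ℕ} (hp : p.Prime)
    (hq : q.Prime) (hpq : p ≠ q) (F : Subgroup G) :
    coprimeCentralizer p F ⊓ coprimeCentralizer q F ≤ Subgroup.centralizer (F : Set G) := by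
  rw [Subgroup.le_centralizer_iff]
  refine le_of_prime_power_mem fun r hr f hf hfr => Subgroup.mem_centralizer_iff.2 fun x hx => ?_
  by_cases hpr : p = r
  · exact (mem_coprimeCentralizer.1 hx.2 f hf
      (coprime_orderOf_of_prime_power hq hr (fun h => hpq (hpr.trans h.symm)) hfr)).symm
  · exact (mem_coprimeCentralizer.1 hx.1 f hf (coprime_orderOf_of_prime_power hp hr hpr hfr)).symm

theorem commutator_mem_centralizer {G : Type*} [Group G] [Finite G] {p q : ℕ} (hp : p.Prime)
    (hq : q.Prime) (hpq : p ≠ q) {F : Subgroup G} {x y : G}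
    (hxN : x ∈ Subgroup.normalizer (F : Set G)) (hyN : y ∈ Subgroup.normalizer (F : Set G))
    (hx : x ∈ coprimeCentralizer p F) (hy : y ∈ coprimeCentralizer q F) :
    x * y * x⁻¹ * y⁻¹ ∈ Subgroup.centralizer (F : Set G) := by
  refine inf_coprimeCentralizer_le hp hq hpq F ⟨?_, ?_⟩
  · have := mul_mem hx (conj_mem_coprimeCentralizer hyN (inv_mem hx))
    simpa [mul_assoc] using this
  · exact (coprimeCentralizer q F).mul_mem (conj_mem_coprimeCentralizer hxN hy)
      ((coprimeCentralizer q F).inv_mem hy)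

theorem IsPGroup.exists_pow_eq_one {G : Type*} [Group G] {p : ℕ} {Q : Subgroup G}
    (h : IsPGroup p Q) {x : G} (hx : x ∈ Q) : ∃ k, x ^ p ^ k = 1 := by
  obtain ⟨k, hk⟩ := h ⟨x, hx⟩
  exact ⟨k, by simpa [Subtype.ext_iff] using hk⟩

/-- Let `a` centralize `F` and let `y` normalize `F` and centralize the elements of `F` of order
prime to `q`. If `y` and `a * y` are `q`-elements, then so is `a`. -/
theorem prime_power_of_mul_prime_power {G : Type*} [Group G] [Finite G] {q : ℕ} (hq : q.Prime)
    {F : Subgroup G} (hC : Subgroup.centralizer (F : Set G) ≤ F) {a y : G}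
    (ha : a ∈ Subgroup.centralizer (F : Set G)) (hyN : y ∈ Subgroup.normalizer (F : Set G))
    (hy : y ∈ coprimeCentralizer q F) (hyq : ∃ k, y ^ q ^ k = 1)
    (hay : ∃ k, (a * y) ^ q ^ k = 1) : ∃ k, a ^ q ^ k = 1 := by
  have := Fact.mk hq
  set A := Subgroup.centralizer (F : Set G) with hA
  have hcomm : ∀ u ∈ A, ∀ v ∈ A, Commute u v := fun u hu v hv =>
    ((Subgroup.mem_centralizer_iff.1 hv) u (hC hu))
  -- the subgroup of `q`-elements of `A`
  let Aq : Subgroup G :=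
    { carrier := {u | u ∈ A ∧ ∃ k, u ^ q ^ k = 1}
      one_mem' := ⟨one_mem _, 0, one_pow _⟩
      mul_mem' := by
        rintro u v ⟨hu, k, hk⟩ ⟨hv, l, hl⟩
        refine ⟨mul_mem hu hv, k + l, ?_⟩
        rw [(hcomm u hu v hv).mul_pow, pow_add, pow_mul, hk, one_pow, one_mul, mul_comm, pow_mul,
          hl, one_pow]
      inv_mem' := by
        rintro u ⟨hu, k, hk⟩
        exact ⟨inv_mem hu, k, by rw [inv_pow, hk, inv_one]⟩ }
  have hAqP : IsPGroup q Aq := isPGroup_of_forall_pow fun x hx => hx.2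
  have hAN : ∀ g ∈ Subgroup.normalizer (F : Set G), ∀ u ∈ A, g * u * g⁻¹ ∈ A := by
    intro g hg u hu
    rw [hA, Subgroup.mem_centralizer_iff]
    intro f hf
    have h1 : g⁻¹ * f * g ∈ F := by
      simpa using (Subgroup.mem_normalizer_iff.1 (inv_mem hg) f).1 hf
    have h2 : Commute (g⁻¹ * f * g) u := Subgroup.mem_centralizer_iff.1 hu _ h1
    have := h2.map (MulAut.conj g).toMonoidHom
    simpa [mul_assoc, Commute, SemiconjBy] using this
  have hAqN : ∀ g ∈ Subgroup.normalizer (F : Set G), ∀ u ∈ Aq, g * u * g⁻¹ ∈ Aq := by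
    rintro g hg u ⟨hu, k, hk⟩
    exact ⟨hAN g hg u hu, k, by rw [conj_pow, hk]; simp⟩
  have hyAq : Subgroup.zpowers y ≤ Subgroup.normalizer (Aq : Set G) := by
    rw [Subgroup.zpowers_le, Subgroup.mem_normalizer_iff]
    intro u
    refine ⟨hAqN y hyN u, fun h => ?_⟩
    have := hAqN y⁻¹ (inv_mem hyN) _ h
    simpa [mul_assoc] using this
  have hQ : IsPGroup q (Subgroup.zpowers y ⊔ Aq : Subgroup G) :=
    (isPGroup_zpowers hyq).to_sup_of_normal_right' hAqP hyAq
  -- split `a` into its `q`-part `u` and its `q'`-part `b`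
  obtain ⟨k, l, hql, hn⟩ := Nat.exists_eq_pow_mul_and_not_dvd (orderOf_pos a).ne' q hq.ne_one
  have hcop : (l : ℕ).Coprime (q ^ k) :=
    (((Nat.Prime.coprime_iff_not_dvd hq).2 hql).pow_left k).symm
  obtain ⟨s, t, hst⟩ : ∃ s t : ℤ, s * l + t * (q ^ k : ℕ) = 1 :=
    Nat.isCoprime_iff_coprime.2 hcop
  set u := a ^ (s * l) with hu
  set b := a ^ (t * (q ^ k : ℕ)) with hb
  have hub : u * b = a := by rw [hu, hb, ← zpow_add, hst, zpow_one]
  have huA : u ∈ Aq := by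
    refine ⟨zpow_mem ha _, k, ?_⟩
    rw [hu, ← zpow_natCast, ← zpow_mul,
      show s * l * ((q ^ k : ℕ) : ℤ) = (orderOf a : ℤ) * s by rw [hn]; push_cast; ring, zpow_mul,
      zpow_natCast, pow_orderOf_eq_one, one_zpow]
  have hbA : b ∈ A := zpow_mem ha _
  have hbl : b ^ l = 1 := by
    rw [hb, ← zpow_natCast, ← zpow_mul,
      show t * ((q ^ k : ℕ) : ℤ) * (l : ℤ) = (orderOf a : ℤ) * t by rw [hn]; push_cast; ring,
      zpow_mul, zpow_natCast, pow_orderOf_eq_one, one_zpow]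
  have hbcop : q.Coprime (orderOf b) :=
    ((Nat.Prime.coprime_iff_not_dvd hq).2 hql).coprime_dvd_right (orderOf_dvd_of_pow_eq_one hbl)
  have hby : Commute b y := mem_coprimeCentralizer.1 hy b (hC hbA) hbcop
  have hbu : Commute b u := hcomm b hbA u huA.1
  have huy : ∃ k, (u * y) ^ q ^ k = 1 :=
    hQ.exists_pow_eq_one (mul_mem (Subgroup.mem_sup_right huA)
      (Subgroup.mem_sup_left (Subgroup.mem_zpowers y)))
  -- The element b commutes with u * y, and both u * y and b * (u * y) = a * y are q-elements; so b
  -- is a q-element of order prime to q.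
  have hb1 : b = 1 := by
    refine eq_one_of_prime_power_of_coprime ?_ hbcop
    obtain ⟨i, hi⟩ := huy
    obtain ⟨j, hj⟩ := hay
    have hc : Commute b (u * y) := hbu.mul_right hby
    have he : a * y = b * (u * y) := by rw [← mul_assoc, hbu.eq, hub]
    refine ⟨i + j, ?_⟩
    have h1 : (a * y) ^ q ^ (i + j) = 1 := by rw [pow_add, mul_comm, pow_mul, hj, one_pow]
    have h2 : (u * y) ^ q ^ (i + j) = 1 := by rw [pow_add, pow_mul, hi, one_pow]
    rwa [he, hc.mul_pow, h2, mul_one] at h1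
  rw [← hub, hb1, mul_one]
  exact huA.2

/-- The commutator centralizes F. Times y it is a conjugate of y, so it is a q-element by
`prime_power_of_mul_prime_power`; by symmetry it is also a p-element, hence trivial. -/
theorem commute_of_mem_coprimeCentralizer {G : Type*} [Group G] [Finite G] {p q : ℕ}
    (hp : p.Prime) (hq : q.Prime) (hpq : p ≠ q) {F : Subgroup G}
    (hC : Subgroup.centralizer (F : Set G) ≤ F) {x y : G}
    (hxN : x ∈ Subgroup.normalizer (F : Set G)) (hyN : y ∈ Subgroup.normalizer (F : Set G))
    (hx : x ∈ coprimeCentralizer p F) (hy : y ∈ coprimeCentralizer q F)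
    (hxp : ∃ k, x ^ p ^ k = 1) (hyq : ∃ k, y ^ q ^ k = 1) : Commute x y := by
  have hz := commutator_mem_centralizer hp hq hpq hxN hyN hx hy
  have hzq : ∃ k, (x * y * x⁻¹ * y⁻¹) ^ q ^ k = 1 := by
    refine prime_power_of_mul_prime_power hq hC hz hyN hy hyq ?_
    obtain ⟨k, hk⟩ := hyq
    exact ⟨k, by rw [inv_mul_cancel_right, conj_pow, hk]; simp⟩
  have hz' := commutator_mem_centralizer hq hp hpq.symm hyN hxN hy hx
  have hzp : ∃ k, (y * x * y⁻¹ * x⁻¹) ^ p ^ k = 1 := by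
    refine prime_power_of_mul_prime_power hp hC hz' hxN hx hxp ?_
    obtain ⟨k, hk⟩ := hxp
    exact ⟨k, by rw [inv_mul_cancel_right, conj_pow, hk]; simp⟩
  have hzp' : ∃ k, (x * y * x⁻¹ * y⁻¹) ^ p ^ k = 1 := by
    obtain ⟨k, hk⟩ := hzp
    refine ⟨k, ?_⟩
    rw [show x * y * x⁻¹ * y⁻¹ = (y * x * y⁻¹ * x⁻¹)⁻¹ by group, inv_pow, hk, inv_one]
  have h1 := eq_one_of_prime_power_of_coprime hzp' (coprime_orderOf_of_prime_power hp hq hpq hzq)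
  rw [mul_inv_eq_one, mul_inv_eq_iff_eq_mul] at h1
  exact h1

/-! ### Maximal nilpotent subgroups above F and their conjugacy. -/

theorem isNilpotent_of_le {G : Type*} [Group G] {H K : Subgroup G} (h : H ≤ K)
    (hK : Group.IsNilpotent K) : Group.IsNilpotent H :=
  Group.nilpotent_of_mulEquiv (Subgroup.subgroupOfEquivOfLe h)

theorem isNilpotent_sup_of_commute {G : Type*} [Group G] {H K : Subgroup G}
    (hH : Group.IsNilpotent H) (hK : Group.IsNilpotent K)
    (hHK : ∀ x ∈ H, ∀ y ∈ K, Commute x y) : Group.IsNilpotent (H ⊔ K : Subgroup G) := by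
  have hr := MonoidHom.noncommCoprod_range H.subtype K.subtype
    (fun x y => hHK x x.2 y y.2)
  rw [Subgroup.range_subtype, Subgroup.range_subtype] at hr
  rw [← hr]
  exact Group.nilpotent_of_surjective _ (MonoidHom.rangeRestrict_surjective _)

theorem exists_isMaximalNilpotentIn_ge {G : Type*} [Group G] [Finite G] {X H : Subgroup G}
    (hHX : H ≤ X) (hH : Group.IsNilpotent H) : ∃ I, IsMaximalNilpotentIn X I ∧ H ≤ I := by
  obtain ⟨I, hHI, hI⟩ := (Set.toFinite {K : Subgroup G | K ≤ X ∧ Group.IsNilpotent K}).exists_le_maximal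
    (a := H) ⟨hHX, hH⟩
  exact ⟨I, hI, hHI⟩

/-- Q commutes with the elements of I of prime power order for primes other than p. Together they
generate a nilpotent subgroup containing I, which maximality forces to be I. -/
theorem IsMaximalNilpotentIn.le_of_isPGroup {G : Type*} [Group G] [Finite G] {F X I Q : Subgroup G}
    (hC : Subgroup.centralizer (F : Set G) ≤ F) (hXN : X ≤ Subgroup.normalizer (F : Set G))
    (hI : IsMaximalNilpotentIn X I) (hFI : F ≤ I) {p : ℕ} (hp : p.Prime) (hQX : Q ≤ X)
    (hQC : Q ≤ coprimeCentralizer p F) (hQ : IsPGroup p Q)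
    (hIQ : ∀ x ∈ I, (∃ k, x ^ p ^ k = 1) → x ∈ Q) : Q ≤ I := by
  have := Fact.mk hp
  have hIX := hI.prop.1
  have hIn := hI.prop.2
  let S : Set G := {y | y ∈ I ∧ ∃ q : ℕ, q.Prime ∧ q ≠ p ∧ ∃ k, y ^ q ^ k = 1}
  have hRI : Subgroup.closure S ≤ I := (Subgroup.closure_le I).2 fun y hy => hy.1
  have hcomm : Subgroup.closure S ≤ Subgroup.centralizer (Q : Set G) := by
    rw [Subgroup.closure_le]
    rintro y ⟨hyI, q, hq, hqp, hyq⟩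
    rw [SetLike.mem_coe, Subgroup.mem_centralizer_iff]
    intro x hx
    exact commute_of_mem_coprimeCentralizer hp hq hqp.symm hC (hXN (hQX hx)) (hXN (hIX hyI))
      (hQC hx) (mem_coprimeCentralizer_of_isNilpotent hFI hIn hyI hyq)
      (hQ.exists_pow_eq_one hx) hyq
  have hle : I ≤ Q ⊔ Subgroup.closure S := by
    refine le_of_prime_power_mem fun q hq x hx hxq => ?_
    by_cases hqp : q = p
    · subst hqp
      exact Subgroup.mem_sup_left (hIQ x hx hxq)
    · exact Subgroup.mem_sup_right (Subgroup.subset_closure ⟨hx, q, hq, hqp, hxq⟩)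
  have hn : Group.IsNilpotent (Q ⊔ Subgroup.closure S : Subgroup G) :=
    isNilpotent_sup_of_commute hQ.isNilpotent (isNilpotent_of_le hRI hIn)
      fun x hx y hy => Subgroup.mem_centralizer_iff.1 (hcomm hy) x hx
  exact le_sup_left.trans (hI.le_of_ge ⟨sup_le hQX (hRI.trans hIX), hn⟩ hle)

theorem IsMaximalNilpotentIn.exists_sylow {G : Type*} [Group G] [Finite G] {F X I : Subgroup G}
    (hC : Subgroup.centralizer (F : Set G) ≤ F) (hXN : X ≤ Subgroup.normalizer (F : Set G))
    (hI : IsMaximalNilpotentIn X I) (hFI : F ≤ I) {p : ℕ} (hp : p.Prime) :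
    ∃ P : Sylow p (X ⊓ coprimeCentralizer p F : Subgroup G),
      ∀ x : (X ⊓ coprimeCentralizer p F : Subgroup G), (∃ k, x ^ p ^ k = 1) →
        ((x : G) ∈ I ↔ x ∈ P) := by
  have := Fact.mk hp
  have hIn : Group.IsNilpotent I := hI.prop.2
  set D := X ⊓ coprimeCentralizer p F with hD
  obtain ⟨S⟩ : Nonempty (Sylow p I) := inferInstance
  have hSD : (S : Subgroup I).map I.subtype ≤ D := by
    rintro _ ⟨x, hx, rfl⟩
    exact ⟨hI.prop.1 x.2, mem_coprimeCentralizer_of_isNilpotent hFI hIn x.2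
      ((S.isPGroup'.map I.subtype).exists_pow_eq_one (Subgroup.mem_map_of_mem _ hx))⟩
  have hSp : IsPGroup p (((S : Subgroup I).map I.subtype).subgroupOf D) :=
    (S.isPGroup'.map I.subtype).of_equiv (Subgroup.subgroupOfEquivOfLe hSD).symm
  obtain ⟨P, hP⟩ := hSp.exists_le_sylow
  have hmem : ∀ x ∈ I, (∃ k, x ^ p ^ k = 1) → x ∈ (P : Subgroup D).map D.subtype := by
    intro x hx hxp
    have h1 : x ∈ (S : Subgroup I).map I.subtype :=
      ⟨⟨x, hx⟩, mem_sylow_of_prime_power S hx hxp, rfl⟩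
    exact ⟨⟨x, hSD h1⟩, hP (Subgroup.mem_subgroupOf.2 h1), rfl⟩
  have hle : (P : Subgroup D).map D.subtype ≤ I :=
    hI.le_of_isPGroup hC hXN hFI hp ((Subgroup.map_subtype_le _).trans inf_le_left)
      ((Subgroup.map_subtype_le _).trans inf_le_right) (P.isPGroup'.map _) hmem
  refine ⟨P, fun x hxp => ⟨fun hx => ?_, fun hx => hle (Subgroup.mem_map_of_mem _ hx)⟩⟩
  obtain ⟨k, hk⟩ := hxp
  obtain ⟨y, hy, hyx⟩ := hmem x hx ⟨k, by simpa [Subtype.ext_iff] using hk⟩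
  rwa [← Subtype.ext hyx]

theorem IsMaximalNilpotentIn.smul {G : Type*} [Group G] {X I : Subgroup G}
    (hI : IsMaximalNilpotentIn X I) {φ : MulAut G} (hφ : φ • X = X) :
    IsMaximalNilpotentIn X (φ • I) := by
  have key : ∀ (ψ : MulAut G) (K : Subgroup G), ψ • X = X → K ≤ X ∧ Group.IsNilpotent K →
      ψ • K ≤ X ∧ Group.IsNilpotent (ψ • K : Subgroup G) := fun ψ K hψ hK => by
    have := hK.2
    refine ⟨?_, Group.nilpotent_of_mulEquiv (Subgroup.equivSMul ψ K)⟩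
    rw [← hψ]
    exact Subgroup.pointwise_smul_le_pointwise_smul_iff.2 hK.1
  refine ⟨key φ I hφ hI.prop, fun K hK hIK => ?_⟩
  have h1 := hI.le_of_ge (key φ⁻¹ K (by rw [inv_smul_eq_iff, hφ]) hK)
    (Subgroup.subset_pointwise_smul_iff.2 (by simpa using hIK))
  rwa [Subgroup.pointwise_smul_subset_iff, inv_inv] at h1

theorem conj_smul_eq_self_of_mem {G : Type*} [Group G] {X : Subgroup G} {c : G} (hc : c ∈ X) :
    MulAut.conj c • X = X :=
  Subgroup.conj_smul_eq_self_of_mem hc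

theorem le_conj_smul {G : Type*} [Group G] {F I : Subgroup G} {c : G}
    (hc : c ∈ Subgroup.normalizer (F : Set G)) (h : F ≤ I) : F ≤ MulAut.conj c • I := by
  intro f hf
  rw [Subgroup.mem_pointwise_smul_iff_inv_smul_mem]
  refine h ?_
  simpa using (Subgroup.mem_normalizer_iff.1 (inv_mem hc) f).1 hf

/-- Maximal nilpotent subgroups above `F` can be made to agree on `p`-elements by a conjugation
that does not affect the `q`-elements for `q ≠ p`. -/
theorem IsMaximalNilpotentIn.exists_conj_prime {G : Type*} [Group G] [Finite G]
    {F X I J : Subgroup G}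
    (hC : Subgroup.centralizer (F : Set G) ≤ F) (hXN : X ≤ Subgroup.normalizer (F : Set G))
    (hI : IsMaximalNilpotentIn X I) (hJ : IsMaximalNilpotentIn X J) (hFI : F ≤ I) (hFJ : F ≤ J)
    {p : ℕ} (hp : p.Prime) :
    ∃ c ∈ X, (∀ x, (∃ k, x ^ p ^ k = 1) → (x ∈ MulAut.conj c • I ↔ x ∈ J)) ∧
      ∀ q : ℕ, q.Prime → q ≠ p → ∀ x, (∃ k, x ^ q ^ k = 1) → (x ∈ MulAut.conj c • I ↔ x ∈ I) := by
  have := Fact.mk hp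
  obtain ⟨P, hP⟩ := hI.exists_sylow hC hXN hFI hp
  obtain ⟨Q, hQ⟩ := hJ.exists_sylow hC hXN hFJ hp
  obtain ⟨c, hc⟩ := MulAction.exists_smul_eq (X ⊓ coprimeCentralizer p F : Subgroup G) P Q
  have hcX : (c : G) ∈ X := c.2.1
  have hcI : IsMaximalNilpotentIn X (MulAut.conj (c : G) • I) :=
    hI.smul (conj_smul_eq_self_of_mem hcX)
  have hFcI : F ≤ MulAut.conj (c : G) • I := le_conj_smul (hXN hcX) hFI
  refine ⟨c, hcX, fun x hxp => ?_, fun q hq hqp x hxq => ?_⟩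
  · have key : ∀ x : (X ⊓ coprimeCentralizer p F : Subgroup G), (∃ k, x ^ p ^ k = 1) →
        ((x : G) ∈ MulAut.conj (c : G) • I ↔ (x : G) ∈ J) := by
      intro x hx
      rw [hQ x hx, ← hc, Subgroup.mem_pointwise_smul_iff_inv_smul_mem, Sylow.smul_def]
      change _ ↔ x ∈ MulAut.conj c • (P : Subgroup _)
      rw [Subgroup.mem_pointwise_smul_iff_inv_smul_mem]
      have := hP (c⁻¹ * x * c) (by
        obtain ⟨k, hk⟩ := hx
        refine ⟨k, ?_⟩
        have := conj_pow (i := p ^ k) (a := c⁻¹) (b := x)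
        rw [inv_inv] at this
        rw [this, hk]; simp)
      simp only [MulAut.smul_def, MulAut.conj_inv_apply, Subgroup.coe_mul,
        Subgroup.coe_inv] at this ⊢
      exact this
    constructor
    · intro h
      exact (key ⟨x, hcI.prop.1 h, mem_coprimeCentralizer_of_isNilpotent hFcI hcI.prop.2 h hxp⟩
        (by simpa [Subtype.ext_iff] using hxp)).1 h
    · intro h
      exact (key ⟨x, hJ.prop.1 h, mem_coprimeCentralizer_of_isNilpotent hFJ hJ.prop.2 h hxp⟩
        (by simpa [Subtype.ext_iff] using hxp)).2 h
  -- The commutator of d and y lies in C(F) ≤ F ≤ K, so conjugation by d moves y only within K.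
  · have key : ∀ d ∈ X ⊓ coprimeCentralizer p F, ∀ K, IsMaximalNilpotentIn X K → F ≤ K →
        ∀ y ∈ K, (∃ k, y ^ q ^ k = 1) → d * y * d⁻¹ ∈ K := by
      intro d hd K hK hFK y hy hyq
      have h1 := hC (commutator_mem_centralizer hp hq hqp.symm (hXN hd.1) (hXN (hK.prop.1 hy))
        hd.2 (mem_coprimeCentralizer_of_isNilpotent hFK hK.prop.2 hy hyq))
      have := mul_mem (hFK h1) hy
      simpa using this
    constructor
    · intro h
      rw [Subgroup.mem_pointwise_smul_iff_inv_smul_mem] at h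
      have := key c c.2 I hI hFI _ h (by
        obtain ⟨k, hk⟩ := hxq
        exact ⟨k, by rw [← smul_pow', hk, smul_one]⟩)
      simpa [mul_assoc] using this
    · intro h
      rw [Subgroup.mem_pointwise_smul_iff_inv_smul_mem]
      have := key _ (inv_mem c.2) I hI hFI x h hxq
      simpa using this

theorem IsMaximalNilpotentIn.exists_conj {G : Type*} [Group G] [Finite G] {F X I J : Subgroup G}
    (hC : Subgroup.centralizer (F : Set G) ≤ F) (hXN : X ≤ Subgroup.normalizer (F : Set G))
    (hI : IsMaximalNilpotentIn X I) (hJ : IsMaximalNilpotentIn X J) (hFI : F ≤ I) (hFJ : F ≤ J) :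
    ∃ c ∈ X, MulAut.conj c • I = J := by
  have key : ∀ s : Finset ℕ, (∀ p ∈ s, p.Prime) → ∃ c ∈ X,
      ∀ p ∈ s, ∀ x, (∃ k, x ^ p ^ k = 1) → (x ∈ MulAut.conj c • I ↔ x ∈ J) := by
    intro s
    induction s using Finset.induction_on with
    | empty => exact fun _ => ⟨1, one_mem _, by simp⟩
    | insert p s hps ih =>
      intro hs
      obtain ⟨c, hcX, hc⟩ := ih fun q hq => hs q (Finset.mem_insert_of_mem hq)
      obtain ⟨d, hdX, hd1, hd2⟩ := (hI.smul (conj_smul_eq_self_of_mem hcX)).exists_conj_prime hC hXN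
        hJ (le_conj_smul (hXN hcX) hFI) hFJ (hs p (Finset.mem_insert_self _ _))
      refine ⟨d * c, mul_mem hdX hcX, fun q hq x hx => ?_⟩
      rw [map_mul, mul_smul]
      rcases Finset.mem_insert.1 hq with rfl | hqs
      · exact hd1 x hx
      · rw [hd2 q (hs q hq) (fun h => hps (h ▸ hqs)) x hx, hc q hqs x hx]
  obtain ⟨c, hcX, hc⟩ := key (Nat.card G).primeFactors fun p hp => Nat.prime_of_mem_primeFactors hp
  have hc' : ∀ p : ℕ, p.Prime → ∀ x, (∃ k, x ^ p ^ k = 1) → (x ∈ MulAut.conj c • I ↔ x ∈ J) := by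
    intro p hp x hx
    by_cases hpG : p ∣ Nat.card G
    · exact hc p (Nat.mem_primeFactors.2 ⟨hp, hpG, Nat.card_pos.ne'⟩) x hx
    · have : x = 1 := eq_one_of_prime_power_of_coprime hx
        (((Nat.Prime.coprime_iff_not_dvd hp).2 hpG).coprime_dvd_right (orderOf_dvd_natCard x))
      simp [this, one_mem]
  exact ⟨c, hcX, le_antisymm (le_of_prime_power_mem fun p hp x hx hxp => (hc' p hp x hxp).1 hx)
    (le_of_prime_power_mem fun p hp x hx hxp => (hc' p hp x hxp).2 hx)⟩

/-! ### The count when X normalizes F. -/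

theorem modEq_one_of_forall_prime_dvd {m n : ℕ} (hn : n ≠ 0)
    (h : ∀ q : ℕ, q.Prime → q ∣ n → q ≡ 1 [MOD m]) : n ≡ 1 [MOD m] := by
  induction n using Nat.recOnMul with
  | zero => exact absurd rfl hn
  | one => rfl
  | prime p hp => exact h p hp dvd_rfl
  | mul a b iha ihb =>
    have ha := iha (left_ne_zero_of_mul hn) fun q hq hqa => h q hq (hqa.mul_right b)
    have hb := ihb (right_ne_zero_of_mul hn) fun q hq hqb => h q hq (hqb.mul_left a)
    simpa using ha.mul hb

/-- Under `h` a Sylow p-subgroup of X containing that of I satisfies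
`IsMaximalNilpotentIn.le_of_isPGroup`, so I contains it. -/
theorem IsMaximalNilpotentIn.not_dvd_relIndex {G : Type*} [Group G] [Finite G]
    {F X I : Subgroup G}
    (hC : Subgroup.centralizer (F : Set G) ≤ F) (hXN : X ≤ Subgroup.normalizer (F : Set G))
    (hI : IsMaximalNilpotentIn X I) (hFI : F ≤ I) {p : ℕ} (hp : p.Prime)
    (h : ∀ x ∈ X, (∃ k, x ^ p ^ k = 1) → x ∈ coprimeCentralizer p F) :
    ¬ p ∣ I.relIndex X := by
  have := Fact.mk hp
  have hIn : Group.IsNilpotent I := hI.prop.2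
  obtain ⟨S⟩ : Nonempty (Sylow p I) := inferInstance
  have hSX : (S : Subgroup I).map I.subtype ≤ X := (Subgroup.map_subtype_le _).trans hI.prop.1
  obtain ⟨P, hP⟩ := IsPGroup.exists_le_sylow
    ((S.isPGroup'.map I.subtype).of_equiv (Subgroup.subgroupOfEquivOfLe hSX).symm)
  have hPX : (P : Subgroup X).map X.subtype ≤ X := Subgroup.map_subtype_le _
  have hPI : (P : Subgroup X).map X.subtype ≤ I := by
    refine hI.le_of_isPGroup hC hXN hFI hp hPX
      (fun x hx => h x (hPX hx) ((P.isPGroup'.map X.subtype).exists_pow_eq_one hx))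
      (P.isPGroup'.map X.subtype) fun x hx hxp => ?_
    have h1 : x ∈ (S : Subgroup I).map I.subtype :=
      ⟨⟨x, hx⟩, mem_sylow_of_prime_power S hx hxp, rfl⟩
    exact ⟨⟨x, hSX h1⟩, hP (Subgroup.mem_subgroupOf.2 h1), rfl⟩
  intro hdvd
  exact P.not_dvd_index (hdvd.trans (Subgroup.index_dvd_of_le (Subgroup.map_le_iff_le_comap.1 hPI)))

/-- These subgroups form one X-orbit, whose length divides the index of I in X. The alternative in
`h` keeps every prime not congruent to 1 out of that index. -/
theorem ncard_maximalNilpotent_modEq_one_of_le_normalizer {G : Type*} [Group G] [Finite G] {m : ℕ}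
    {F X : Subgroup G} (hC : Subgroup.centralizer (F : Set G) ≤ F) (hFX : F ≤ X)
    (hXN : X ≤ Subgroup.normalizer (F : Set G)) (hF : Group.IsNilpotent F)
    (h : ∀ q : ℕ, q.Prime → q ≡ 1 [MOD m] ∨
      ∀ x ∈ X, (∃ k, x ^ q ^ k = 1) → x ∈ coprimeCentralizer q F) :
    {I : Subgroup G | IsMaximalNilpotentIn X I ∧ F ≤ I}.ncard ≡ 1 [MOD m] := by
  obtain ⟨I, hI, hFI⟩ := exists_isMaximalNilpotentIn_ge hFX hF
  let _ : MulAction X (Subgroup G) := MulAction.compHom _ (MulAut.conj.comp X.subtype)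
  have hsmul : ∀ (c : X) (K : Subgroup G), c • K = MulAut.conj (c : G) • K := fun c K => rfl
  have horb : {J : Subgroup G | IsMaximalNilpotentIn X J ∧ F ≤ J} = MulAction.orbit X I := by
    ext J
    constructor
    · rintro ⟨hJ, hFJ⟩
      obtain ⟨c, hcX, hc⟩ := hI.exists_conj hC hXN hJ hFI hFJ
      exact ⟨⟨c, hcX⟩, hc⟩
    · rintro ⟨c, rfl⟩
      exact ⟨hI.smul (conj_smul_eq_self_of_mem c.2), le_conj_smul (hXN c.2) hFI⟩
  rw [horb, ← MulAction.index_stabilizer]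
  have hstab : I.subgroupOf X ≤ MulAction.stabilizer X I := fun c hc =>
    MulAction.mem_stabilizer_iff.2
      ((hsmul c I).trans (Subgroup.conj_smul_eq_self_of_mem (Subgroup.mem_subgroupOf.1 hc)))
  refine modEq_one_of_forall_prime_dvd Subgroup.FiniteIndex.index_ne_zero fun q hq hdvd => ?_
  refine (h q hq).resolve_right fun hX => ?_
  exact hI.not_dvd_relIndex hC hXN hFI hq hX (hdvd.trans (Subgroup.index_dvd_of_le hstab))

/-! ### Passing from F to a larger subgroup H. -/

theorem natCast_card_filter_comp {ι α : Type*} [Fintype α] [DecidableEq α] (m : ℕ) (A : Finset ι)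
    (f : ι → α) (P : α → Prop) [DecidablePred P] :
    ((A.filter (fun a => P (f a))).card : ZMod m) =
      ∑ s ∈ Finset.univ.filter P, ((A.filter (fun a => f a = s)).card : ZMod m) := by
  rw [Finset.card_eq_sum_card_fiberwise (f := f) (t := Finset.univ.filter P) (by
    intro a ha
    simpa using (Finset.mem_filter.1 ha).2), Nat.cast_sum]
  refine Finset.sum_congr rfl fun s hs => ?_
  rw [Finset.filter_filter]
  congr 2
  refine Finset.filter_congr fun a _ => ?_
  exact ⟨fun h => h.2, fun h => ⟨h ▸ (Finset.mem_filter.1 hs).2, h⟩⟩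

/-- Two families in a finite partial order that are equidistributed over all upper sets `Ici t`,
`t ∈ U`, are equidistributed over the upper set `U`. -/
theorem card_filter_mem_modEq_of_forall_le {ι κ α : Type*} [PartialOrder α] [Finite α]
    (A : Finset ι) (B : Finset κ) (f : ι → α) (g : κ → α) (m : ℕ) (U : Set α) (hU : IsUpperSet U)
    [DecidablePred (· ∈ U)] [DecidableLE α]
    (h : ∀ t ∈ U, (A.filter (fun a => t ≤ f a)).card ≡ (B.filter (fun b => t ≤ g b)).card [MOD m]) :
    (A.filter (fun a => f a ∈ U)).card ≡ (B.filter (fun b => g b ∈ U)).card [MOD m] := by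
  classical
  have := Fintype.ofFinite α
  have key : ∀ t, t ∈ U → ((A.filter (fun a => f a = t)).card : ZMod m) =
      ((B.filter (fun b => g b = t)).card : ZMod m) := by
    intro t
    induction t using WellFoundedGT.induction with
    | ind t ih =>
      intro ht
      -- Split both counts over `Ici t` by value: the terms with s > t agree by induction and
      -- cancel, leaving the term at t.
      have h1 := (ZMod.natCast_eq_natCast_iff _ _ _).2 (h t ht)
      rw [natCast_card_filter_comp m A f (fun s => t ≤ s), natCast_card_filter_comp m B g (fun s => t ≤ s)] at h1
      have ht' : t ∈ Finset.univ.filter (fun s => t ≤ s) := by simp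
      rw [← Finset.add_sum_erase _ _ ht', ← Finset.add_sum_erase _ _ ht'] at h1
      rw [Finset.sum_congr rfl fun s hs => ?_] at h1
      · exact add_right_cancel h1
      · have h2 : s ≠ t ∧ t ≤ s := by simpa using hs
        exact ih s (lt_of_le_of_ne h2.2 h2.1.symm) (hU h2.2 ht)
  rw [← ZMod.natCast_eq_natCast_iff, natCast_card_filter_comp m A f (· ∈ U), natCast_card_filter_comp m B g (· ∈ U)]
  exact Finset.sum_congr rfl fun s hs => key s (Finset.mem_filter.1 hs).2

theorem lt_inf_normalizer {G : Type*} [Group G] {H K : Subgroup G} (hK : Group.IsNilpotent K)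
    (h : H < K) : H < K ⊓ Subgroup.normalizer (H : Set G) := by
  refine lt_of_le_of_ne (le_inf h.le Subgroup.le_normalizer) fun he => ?_
  have h1 := Group.normalizerCondition_of_isNilpotent (G := K) (H.subgroupOf K) (by
    rw [lt_top_iff_ne_top, ne_eq, Subgroup.subgroupOf_eq_top]
    exact h.not_ge)
  obtain ⟨x, hx, hxH⟩ := SetLike.exists_of_lt h1
  refine hxH (Subgroup.mem_subgroupOf.2 ?_)
  rw [he]
  refine ⟨x.2, ?_⟩
  rw [← Subgroup.subgroupOf_normalizer_eq h.le] at hx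
  exact hx

/-- F and X vary in the induction because it is used for T > H both with the pair (F, X) and with
(H, N). -/
theorem ncard_maximalNilpotent_modEq_one {G : Type*} [Group G] [Finite G] {m : ℕ}
    {F X H : Subgroup G} (hC : Subgroup.centralizer (F : Set G) ≤ F)
    (hXN : X ≤ Subgroup.normalizer (F : Set G))
    (h : ∀ q : ℕ, q.Prime → q ≡ 1 [MOD m] ∨
      ∀ x ∈ X, (∃ k, x ^ q ^ k = 1) → x ∈ coprimeCentralizer q F)
    (hFH : F ≤ H) (hHX : H ≤ X) (hH : Group.IsNilpotent H) :
    {I : Subgroup G | IsMaximalNilpotentIn X I ∧ H ≤ I}.ncard ≡ 1 [MOD m] := by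
  classical
  induction H using WellFoundedGT.induction generalizing F X with
  | ind H ih =>
    by_cases hmax : IsMaximalNilpotentIn X H
    · have : {I : Subgroup G | IsMaximalNilpotentIn X I ∧ H ≤ I} = {H} := by
        ext I
        exact ⟨fun hI => (hmax.eq_of_le hI.1.prop hI.2).symm, fun hI => by
          rw [Set.mem_singleton_iff] at hI
          subst hI
          exact ⟨hmax, le_rfl⟩⟩
      rw [this, Set.ncard_singleton]
    set N := X ⊓ Subgroup.normalizer (H : Set G) with hN
    have hHN : H ≤ N := le_inf hHX Subgroup.le_normalizer
    have hCH : Subgroup.centralizer (H : Set G) ≤ H :=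
      (Subgroup.centralizer_le (show (F : Set G) ⊆ H from hFH)).trans (hC.trans hFH)
    -- The alternative passes from (F, X) to (H, N): q-elements of D_q commute with the r-elements
    -- of H for every r ≠ q, and these generate the elements of H of order prime to q.
    have hNstar : ∀ q : ℕ, q.Prime → q ≡ 1 [MOD m] ∨
        ∀ x ∈ N, (∃ k, x ^ q ^ k = 1) → x ∈ coprimeCentralizer q H := by
      intro q hq
      refine (h q hq).imp_right fun hX x hx hxq => ?_
      refine mem_coprimeCentralizer.2 fun f hf hqf => ?_
      have hz : Subgroup.zpowers f ≤ Subgroup.centralizer {x} := by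
        refine le_of_prime_power_mem fun r hr y hy hyr => ?_
        rw [Subgroup.mem_centralizer_singleton_iff]
        by_cases hrq : r = q
        · subst hrq
          rw [eq_one_of_prime_power_of_coprime hyr
            (hqf.coprime_dvd_right (orderOf_dvd_of_mem_zpowers hy)), mul_one, one_mul]
        · have hyH : y ∈ H := (Subgroup.zpowers_le.2 hf) hy
          exact commute_of_mem_coprimeCentralizer hr hq hrq hC (hXN (hHX hyH)) (hXN hx.1)
            (mem_coprimeCentralizer_of_isNilpotent hFH hH hyH hyr) (hX x hx.1 hxq) hyr hxq
      exact Subgroup.mem_centralizer_singleton_iff.1 (hz (Subgroup.mem_zpowers f))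
    have hNmod := ncard_maximalNilpotent_modEq_one_of_le_normalizer hCH hHN inf_le_right hH hNstar
    refine Nat.ModEq.trans ?_ hNmod
    have hfinA := Set.toFinite {I : Subgroup G | IsMaximalNilpotentIn X I ∧ H ≤ I}
    have hfinB := Set.toFinite {I : Subgroup G | IsMaximalNilpotentIn N I ∧ H ≤ I}
    -- No I counted here equals H, so normalizers grow in the nilpotent group I and I ∩ N is
    -- strictly larger than H.
    have hA : hfinA.toFinset.filter (fun I => I ⊓ N ∈ Set.Ioi H) = hfinA.toFinset := by
      refine Finset.filter_true_of_mem fun I hI => ?_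
      obtain ⟨hI, hHI⟩ := hfinA.mem_toFinset.1 hI
      have hlt : H < I := lt_of_le_of_ne hHI fun he => hmax (he ▸ hI)
      exact (lt_inf_normalizer hI.prop.2 hlt).trans_le
        (le_inf inf_le_left (le_inf (inf_le_left.trans hI.prop.1) inf_le_right))
    -- H is not maximal nilpotent in N either: I ∩ N is strictly larger, for any maximal nilpotent I
    -- of X above H.
    have hB : hfinB.toFinset.filter (fun I => I ∈ Set.Ioi H) = hfinB.toFinset := by
      refine Finset.filter_true_of_mem fun J hJ => ?_
      obtain ⟨hJ, hHJ⟩ := hfinB.mem_toFinset.1 hJ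
      refine lt_of_le_of_ne hHJ fun he => ?_
      subst he
      obtain ⟨I, hI, hHI⟩ := exists_isMaximalNilpotentIn_ge hHX hH
      have hlt : H < I := lt_of_le_of_ne hHI fun he => hmax (he ▸ hI)
      refine (lt_inf_normalizer hI.prop.2 hlt).not_ge (hJ.le_of_ge
        ⟨inf_le_inf_right _ hI.prop.1, isNilpotent_of_le inf_le_left hI.prop.2⟩
        (le_inf hHI Subgroup.le_normalizer))
    rw [Set.ncard_eq_toFinset_card _ hfinA, Set.ncard_eq_toFinset_card _ hfinB, ← hA, ← hB]
    refine card_filter_mem_modEq_of_forall_le _ _ (fun I : Subgroup G => I ⊓ N)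
      (fun I : Subgroup G => I) m (Set.Ioi H) (isUpperSet_Ioi H) fun T hT => ?_
    by_cases hTN : T ≤ N ∧ Group.IsNilpotent T
    · have h1 := ih T hT hC hXN h (hFH.trans hT.le) (hTN.1.trans inf_le_left) hTN.2
      have h2 := ih T hT hCH inf_le_right hNstar hT.le hTN.1 hTN.2
      rw [← Set.ncard_coe_finset, ← Set.ncard_coe_finset]
      convert h1.trans h2.symm using 2
      · ext I
        simp only [Finset.coe_filter, Set.Finite.mem_toFinset, Set.mem_ofPred_eq, le_inf_iff]
        exact ⟨fun hI => ⟨hI.1.1, hI.2.1⟩, fun hI => ⟨⟨hI.1, hT.le.trans hI.2⟩, hI.2, hTN.1⟩⟩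
      · ext I
        simp only [Finset.coe_filter, Set.Finite.mem_toFinset, Set.mem_ofPred_eq]
        exact ⟨fun hI => ⟨hI.1.1, hI.2⟩, fun hI => ⟨⟨hI.1, hT.le.trans hI.2⟩, hI.2⟩⟩
    · rw [Finset.filter_false_of_mem, Finset.filter_false_of_mem]
      · exact fun J hJ hTJ => hTN ⟨hTJ.trans (hfinB.mem_toFinset.1 hJ).1.prop.1,
          isNilpotent_of_le hTJ (hfinB.mem_toFinset.1 hJ).1.prop.2⟩
      · exact fun I hI hTI => hTN ⟨hTI.trans inf_le_right, isNilpotent_of_le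
          (hTI.trans inf_le_left) (hfinA.mem_toFinset.1 hI).1.prop.2⟩

/-! ### Nilpotent injectors and the main theorem. -/

theorem IsNilpotentInjector.isMaximalNilpotentIn_top {G : Type*} [Group G] {I : Subgroup G}
    (hI : IsNilpotentInjector I) : IsMaximalNilpotentIn ⊤ I := by
  simpa using hI ⊤ Subgroup.IsSubnormal.top

theorem IsNilpotentInjector.fittingSubgroup_le {G : Type*} [Group G] {I : Subgroup G}
    (hI : IsNilpotentInjector I) : fittingSubgroup G ≤ I := by
  refine sSup_le fun N hN => ?_
  have h := (hI N hN.1.isSubnormal).eq_of_le ⟨le_rfl, hN.2⟩ inf_le_left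
  exact inf_eq_left.1 h

theorem IsNilpotentInjector.smul {G : Type*} [Group G] {I : Subgroup G}
    (hI : IsNilpotentInjector I) (g : G) : IsNilpotentInjector (MulAut.conj g • I) := by
  intro S hS
  have h1 := hI ((MulAut.conj g)⁻¹ • S) (hS.smul _)
  have key : ∀ (ψ : MulAut G) (S K : Subgroup G), K ≤ S ∧ Group.IsNilpotent K →
      ψ • K ≤ ψ • S ∧ Group.IsNilpotent (ψ • K : Subgroup G) := fun ψ S K hK => by
    have := hK.2
    exact ⟨Subgroup.pointwise_smul_le_pointwise_smul_iff.2 hK.1,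
      Group.nilpotent_of_mulEquiv (Subgroup.equivSMul ψ K)⟩
  have h2 : S ⊓ MulAut.conj g • I = MulAut.conj g • ((MulAut.conj g)⁻¹ • S ⊓ I) := by
    rw [Subgroup.smul_inf, smul_inv_smul]
  rw [h2]
  refine ⟨by simpa using key (MulAut.conj g) _ _ h1.prop, fun K hK hIK => ?_⟩
  rw [Subgroup.pointwise_smul_subset_iff] at hIK
  exact Subgroup.subset_pointwise_smul_iff.2 (h1.le_of_ge (key _ _ _ hK) hIK)

instance fittingSubgroup_normal (G : Type*) [Group G] : (fittingSubgroup G).Normal :=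
  Subgroup.sSup_normal _ fun _ hN => hN.1

theorem injectorModulus_modEq_one {G : Type*} [Group G] [Finite G] {I : Subgroup G}
    (hI : IsNilpotentInjector I) {q : ℕ} (hq : q.Prime) (hqI : q ∣ I.index) :
    q ≡ 1 [MOD injectorModulus G] := by
  classical
  unfold injectorModulus
  split_ifs with hG
  · exact Nat.modEq_one
  · refine ((Nat.modEq_iff_dvd' hq.one_le).2 (Finset.gcd_dvd (f := fun p => p - 1)
      (Finset.mem_filter.2 ⟨?_, I, hI, hqI⟩))).symm
    exact Nat.mem_primeFactors.2 ⟨hq, hqI.trans I.index_dvd_card, Nat.card_pos.ne'⟩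

/-- I contains a Sylow q-subgroup of G, so x is conjugate into I; conjugation preserves D_q because
F is normal. -/
theorem mem_coprimeCentralizer_of_not_dvd_index {G : Type*} [Group G] [Finite G]
    {F I : Subgroup G} [F.Normal] (hFI : F ≤ I) (hI : Group.IsNilpotent I) {q : ℕ} (hq : q.Prime)
    (hqI : ¬ q ∣ I.index) {x : G} (hx : ∃ k, x ^ q ^ k = 1) : x ∈ coprimeCentralizer q F := by
  have := Fact.mk hq
  obtain ⟨S⟩ : Nonempty (Sylow q I) := inferInstance
  have hS : ¬ q ∣ ((S : Subgroup I).map I.subtype).index := by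
    rw [Subgroup.index_map_subtype]
    exact hq.not_dvd_mul S.not_dvd_index hqI
  let T : Sylow q G := (S.isPGroup'.map I.subtype).toSylow hS
  obtain ⟨Q, hQ⟩ := (isPGroup_zpowers hx).exists_le_sylow
  obtain ⟨g, rfl⟩ := MulAction.exists_smul_eq G T Q
  have hxT : x ∈ MulAut.conj g • (T : Subgroup G) := hQ (Subgroup.mem_zpowers x)
  rw [Subgroup.mem_pointwise_smul_iff_inv_smul_mem] at hxT
  have hyI : (MulAut.conj g)⁻¹ • x ∈ I := Subgroup.map_subtype_le _ hxT
  have h1 := mem_coprimeCentralizer_of_isNilpotent (p := q) hFI hI hyI (by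
    obtain ⟨k, hk⟩ := hx
    exact ⟨k, by rw [← smul_pow', hk, smul_one]⟩)
  have h2 := conj_mem_coprimeCentralizer (g := g) (by simp [Subgroup.normalizer_eq_top]) h1
  simpa [mul_assoc] using h2

theorem theoremA {G : Type*} [Group G] [Finite G] (hG : IsNConstrained G) (H : Subgroup G) :
    numNilpotentInjectors H = 0 ∨ numNilpotentInjectors H ≡ 1 [MOD injectorModulus G] := by
  refine or_iff_not_imp_left.2 fun hne => ?_
  obtain ⟨I, hI, hHI⟩ := Set.nonempty_of_ncard_ne_zero hne
  have hFI := hI.fittingSubgroup_le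
  have hIm := hI.isMaximalNilpotentIn_top
  have hN : (⊤ : Subgroup G) ≤ Subgroup.normalizer (fittingSubgroup G : Set G) := by
    rw [Subgroup.normalizer_eq_top]
  have hset : nilpotentInjectorsContaining H =
      {J : Subgroup G | IsMaximalNilpotentIn ⊤ J ∧ fittingSubgroup G ⊔ H ≤ J} := by
    ext J
    constructor
    · rintro ⟨hJ, hHJ⟩
      exact ⟨hJ.isMaximalNilpotentIn_top, sup_le hJ.fittingSubgroup_le hHJ⟩
    -- J is conjugate to the given injector I, and conjugates of injectors are injectors.
    · rintro ⟨hJ, hHJ⟩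
      obtain ⟨c, -, rfl⟩ := hIm.exists_conj hG hN hJ hFI (le_sup_left.trans hHJ)
      exact ⟨hI.smul c, le_sup_right.trans hHJ⟩
  rw [numNilpotentInjectors, hset]
  refine ncard_maximalNilpotent_modEq_one hG hN (fun q hq => ?_) le_sup_left le_top
    (isNilpotent_of_le (sup_le hFI hHI) hIm.prop.2)
  by_cases hqI : q ∣ I.index
  · exact Or.inl (injectorModulus_modEq_one hI hq hqI)
  · exact Or.inr fun x _ hx =>
      mem_coprimeCentralizer_of_not_dvd_index hFI hIm.prop.2 hq hqI hx
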